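/- \textbf{Proposition (Probability of ultimate boundedness).} \emph{Setting.} Let $\mathbb U=\prod_{i=1}^m[u_{\min,i},u_{\max,i}]$ with $u_{\min,i}<0<u_{\max,i}$, let $f:\mathbb R^n\times\mathbb U\to\mathbb R^n$ be $C^1$ with $f(0,0)=0$, let $q:\mathbb R^n\to[0,\infty)$ be smooth with $q(0)=0$, and let $R$ be a symmetric positive definite $m\times m$ matrix. Let $u^*:\mathbb R^n\to\mathbb U$ be an optimal feedback for minimizing $\int_0^\infty \big(q(x)+u^{T}Ru\big)\,dt$ subject to $\dot x=f(x,u)$, $x(0)=x_0$, $u(t)\in\mathbb U$: from every $x_0\in\mathbb R^n$ the feedback $u^*$ generates a trajectory whose cost is finite and minimal among all admissible state-control pairs. Put $f^*_{cl}(x)=f(x,u^*(x))$, let $r>0$ and $\overline{\mathbb B}_r=\{x\in\mathbb R^n:\|x\|_2\le r\}$. Assume that the Jacobian of $f^*_{cl}$ exists and is Lipschitz throughout $\overline{\mathbb B}_r$, that $0$ is an exponentially stable equilibrium of $\dot x=f^*_{cl}(x)$, and that $u^*$ is continuous on $\overline{\mathbb B}_r$. Let $\widehat u:\mathbb R^n\to\mathbb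 U$ be continuous. \emph{Threshold.} Call $\delta^+$ a threshold if \[ \delta^+=\frac{\theta k_3}{L k_4}\sqrt{\frac{k_1}{k_2}}\;\rho \] for some $\theta\in(0,1)$, some $\rho\in(0,r]$, some $L>0$ with $\|f(x,u)-f(x,v)\|_2\le L\|u-v\|_2$ for all $\|x\|_2<\rho$ and $u,v\in\mathbb U$, and some $C^1$ function $W$ on the open ball $\mathbb B_\rho=\{\|x\|_2<\rho\}$ and constants $k_1,\dots,k_4>0$ such that on $\mathbb B_\rho$ \[ k_1\|x\|_2^2\le W(x)\le k_2\|x\|_2^2,\qquad \frac{\partial W}{\partial x}(x)\,f^*_{cl}(x)\le -k_3\|x\|_2^2,\qquad \Big\|\frac{\partial W}{\partial x}(x)\Big\|_2\le k_4\|x\|_2 . \] \emph{Errors.} Let $x^{(1)},\dots,x^{(N)}$, $N\ge1$, be independent random points with a common probability distribution $\mu$ on $\mathbb R^n$ whose support is $\overline{\mathbb B}_r$. Put \[ \delta=\sup_{x\in\overline{\mathbb B}_r}\|\widehat u(x)-u^*(x)\|_2,\qquad \delta_N=\max_{1\le i\le N}\|\widehat u(x^{(i)})-u^*(x^{(i)})\|_2,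 \] \[ F(\delta,\epsilon)=\Pr\nolimits_{x\sim\mu}\big(\delta-\|\widehat u(x)-u^*(x)\|_2>\epsilon\big),\qquad \overline F(\delta,\epsilon)=\Pr\nolimits_{x\sim\mu}\big(\delta-\|\widehat u(x)-u^*(x)\|_2\ge\epsilon\big). \] \emph{Conclusion.} The supremum $\delta$ is attained, and at least one threshold exists. For every threshold $\delta^+$, with data as above, the following hold. (a) The condition $\delta<\delta^+$ is sufficient for ultimate boundedness. Let $K=\sqrt{k_2/k_1}$, $\alpha=\frac{(1-\theta)k_3}{2k_2}$, $B=\frac{Lk_4}{\theta k_3}\sqrt{\frac{k_2}{k_1}}\,\delta$. If $\delta<\delta^+$, then for every solution $x:[0,\infty)\to\mathbb R^n$ of $\dot x=f(x,\widehat u(x))$ with $\|x(0)\|_2<\rho\sqrt{k_1/k_2}$: if $\delta>0$, there is a finite $T\ge0$ with $\|x(t)\|_2\le K\|x(0)\|_2e^{-\alpha t}$ for $0\le t<T$ and $\|x(t)\|_2\le B$ for $t\ge T$; if $\delta=0$, the exponential estimate holds for all $t\ge0$. (b) Suppose that the observed value $d$ of $\delta_N$ (its value at some outcome of the sampling) satisfies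 $d<\delta^+$, and let $\epsilon_N=\delta^+-d>0$ be the resulting tolerance, regarded as fixed. Then the probability, over the $N$ random test points, that the empirical maximum error is within $\epsilon_N$ of the true one is \[ \Pr\big(\delta\le\delta_N+\epsilon_N\big)=1-F(\delta,\epsilon_N)^N>0,\qquad\text{with } F(\delta,\epsilon_N)<1, \] and for the strict inequality \[ \Pr\big(\delta<\delta_N+\epsilon_N\big)=1-\overline F(\delta,\epsilon_N)^N>0,\qquad\text{with } \overline F(\delta,\epsilon_N)<1 . \] -/

import Mathlib

open MeasureTheory
open scoped Matrix ContDiff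

/-- `x` is a classical solution of the autonomous ODE `x' = g(x)` on the time interval `s`
(one-sided derivatives at the end points of `s`). -/
def IsSolutionOn {n : ℕ} (g : EuclideanSpace ℝ (Fin n) → EuclideanSpace ℝ (Fin n))
    (x : ℝ → EuclideanSpace ℝ (Fin n)) (s : Set ℝ) : Prop :=
  ∀ t ∈ s, HasDerivWithinAt x (g (x t)) s t

/-- The origin is an exponentially stable equilibrium of `x' = g(x)`: it is an equilibrium, and
every trajectory starting close enough to it decays exponentially for as long as it is defined. -/
def IsExpStableEquilibrium {n : ℕ}
    (g : EuclideanSpace ℝ (Fin n) → EuclideanSpace ℝ (Fin n)) : Prop :=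
  g 0 = 0 ∧ ∃ c k lam : ℝ, 0 < c ∧ 0 < k ∧ 0 < lam ∧
    ∀ (T : ℝ) (x : ℝ → EuclideanSpace ℝ (Fin n)), 0 < T →
      IsSolutionOn g x (Set.Icc 0 T) → ‖x 0‖ < c →
        ∀ t ∈ Set.Icc 0 T, ‖x t‖ ≤ k * ‖x 0‖ * Real.exp (-lam * t)

/-- The Jacobian of `g` exists and is Lipschitz throughout the closed ball of radius `r`
(at boundary points of the ball, the derivative relative to the ball is meant). -/
def HasLipschitzJacobianOnBall {n : ℕ}
    (g : EuclideanSpace ℝ (Fin n) → EuclideanSpace ℝ (Fin n)) (r : ℝ) : Prop :=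
  DifferentiableOn ℝ g (Metric.closedBall 0 r) ∧
    ∃ K : NNReal, LipschitzOnWith K (fderivWithin ℝ g (Metric.closedBall 0 r))
      (Metric.closedBall 0 r)

/-- Data of an infinite-horizon optimal control problem: minimize
`∫₀^∞ q(x) + uᵀ R u dt` subject to `x' = f(x, u)`, `x(0) = x₀`, `u(t)` in the box
`∏ [umin i, umax i]`. The goal equilibrium is `(x, u) = (0, 0)`. -/
structure ControlProblem (n m : ℕ) where
  f : EuclideanSpace ℝ (Fin n) → EuclideanSpace ℝ (Fin m) → EuclideanSpace ℝ (Fin n)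
  umin : EuclideanSpace ℝ (Fin m)
  umax : EuclideanSpace ℝ (Fin m)
  q : EuclideanSpace ℝ (Fin n) → ℝ
  R : Matrix (Fin m) (Fin m) ℝ
  /-- `u = 0` is an interior point of the box. -/
  umin_neg : ∀ i, umin i < 0
  umax_pos : ∀ i, 0 < umax i
  /-- `f` is continuously differentiable on `ℝⁿ × U`. -/
  contDiffOn_f : ContDiffOn ℝ 1
    (fun p : EuclideanSpace ℝ (Fin n) × EuclideanSpace ℝ (Fin m) => f p.1 p.2)
    (Set.univ ×ˢ {u | ∀ i, umin i ≤ u i ∧ u i ≤ umax i})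
  f_zero : f 0 0 = 0
  contDiff_q : ContDiff ℝ ∞ q
  q_nonneg : ∀ x, 0 ≤ q x
  q_zero : q 0 = 0
  posDef_R : R.PosDef

namespace ControlProblem

variable {n m : ℕ} (P : ControlProblem n m)

/-- The box of admissible control values. -/
def U : Set (EuclideanSpace ℝ (Fin m)) := {u | ∀ i, P.umin i ≤ u i ∧ u i ≤ P.umax i}

/-- The running cost `q(x) + uᵀ R u`. -/
def runningCost (x : EuclideanSpace ℝ (Fin n)) (u : EuclideanSpace ℝ (Fin m)) : ℝ :=
  P.q x + u.ofLp ⬝ᵥ (P.R *ᵥ u.ofLp)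

/-- The total cost (the running cost is nonnegative, so the integral is defined in `[0, ∞]`). -/
noncomputable def cost (x : ℝ → EuclideanSpace ℝ (Fin n)) (u : ℝ → EuclideanSpace ℝ (Fin m)) :
    ENNReal :=
  ∫⁻ t in Set.Ici (0 : ℝ), ENNReal.ofReal (P.runningCost (x t) (u t))

/-- `(x, u)` is an admissible state-control pair from `x₀`: `u` is a measurable `U`-valued
control and `x` is the state, in the integrated (absolutely continuous) sense. -/
def IsAdmissible (x₀ : EuclideanSpace ℝ (Fin n)) (x : ℝ → EuclideanSpace ℝ (Fin n))
    (u : ℝ → EuclideanSpace ℝ (Fin m)) : Prop :=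
  AEMeasurable u (volume.restrict (Set.Ici 0)) ∧ (∀ t, 0 ≤ t → u t ∈ P.U) ∧
    ContinuousOn x (Set.Ici 0) ∧ ∀ t, 0 ≤ t → x t = x₀ + ∫ s in (0 : ℝ)..t, P.f (x s) (u s)

/-- `ustar` is an optimal feedback: it takes values in `U`, and from every initial state the
closed loop it generates has finite cost, not larger than that of any admissible pair. -/
def IsOptimalFeedback
    (ustar : EuclideanSpace ℝ (Fin n) → EuclideanSpace ℝ (Fin m)) : Prop :=
  (∀ x, ustar x ∈ P.U) ∧
    ∀ x₀, ∃ x : ℝ → EuclideanSpace ℝ (Fin n),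
      P.IsAdmissible x₀ x (fun t => ustar (x t)) ∧
      P.cost x (fun t => ustar (x t)) ≠ ⊤ ∧
      ∀ y v, P.IsAdmissible x₀ y v → P.cost x (fun t => ustar (x t)) ≤ P.cost y v

/-- The closed-loop vector field `x ↦ f(x, u(x))` under the feedback `u`. -/
def closedLoop (u : EuclideanSpace ℝ (Fin n) → EuclideanSpace ℝ (Fin m)) :
    EuclideanSpace ℝ (Fin n) → EuclideanSpace ℝ (Fin n) :=
  fun x => P.f x (u x)

/-- The choices that enter the threshold `δ⁺`: a radius `0 < ρ ≤ r`, a `C¹` Lyapunov function `W`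
of quadratic type, with constants `k₁, …, k₄`, for the optimally controlled closed loop on the
open ball of radius `ρ`, a Lipschitz constant `L` of `f` with respect to `u` on that ball, and
`θ ∈ (0, 1)`. -/
structure ThresholdData (ustar : EuclideanSpace ℝ (Fin n) → EuclideanSpace ℝ (Fin m))
    (r : ℝ) where
  ρ : ℝ
  W : EuclideanSpace ℝ (Fin n) → ℝ
  k₁ : ℝ
  k₂ : ℝ
  k₃ : ℝ
  k₄ : ℝ
  L : ℝ
  θ : ℝ
  ρ_pos : 0 < ρ
  ρ_le : ρ ≤ r
  k₁_pos : 0 < k₁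
  k₂_pos : 0 < k₂
  k₃_pos : 0 < k₃
  k₄_pos : 0 < k₄
  L_pos : 0 < L
  θ_pos : 0 < θ
  θ_lt_one : θ < 1
  contDiffOn_W : ContDiffOn ℝ 1 W (Metric.ball 0 ρ)
  lower : ∀ x ∈ Metric.ball (0 : EuclideanSpace ℝ (Fin n)) ρ, k₁ * ‖x‖ ^ 2 ≤ W x
  upper : ∀ x ∈ Metric.ball (0 : EuclideanSpace ℝ (Fin n)) ρ, W x ≤ k₂ * ‖x‖ ^ 2
  decrease : ∀ x ∈ Metric.ball (0 : EuclideanSpace ℝ (Fin n)) ρ,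
    fderiv ℝ W x (P.closedLoop ustar x) ≤ -k₃ * ‖x‖ ^ 2
  gradient : ∀ x ∈ Metric.ball (0 : EuclideanSpace ℝ (Fin n)) ρ, ‖fderiv ℝ W x‖ ≤ k₄ * ‖x‖
  lipschitz : ∀ x ∈ Metric.ball (0 : EuclideanSpace ℝ (Fin n)) ρ, ∀ u ∈ P.U, ∀ v ∈ P.U,
    ‖P.f x u - P.f x v‖ ≤ L * ‖u - v‖

namespace ThresholdData

variable {P} {ustar : EuclideanSpace ℝ (Fin n) → EuclideanSpace ℝ (Fin m)} {r : ℝ}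
  (D : P.ThresholdData ustar r)

/-- The threshold `δ⁺ = (θ k₃ / (L k₄)) √(k₁ / k₂) ρ`. -/
noncomputable def deltaPlus : ℝ := D.θ * D.k₃ / (D.L * D.k₄) * √(D.k₁ / D.k₂) * D.ρ

/-- The overshoot constant `K = √(k₂ / k₁)`. -/
noncomputable def gain : ℝ := √(D.k₂ / D.k₁)

/-- The decay rate `α = (1 - θ) k₃ / (2 k₂)`. -/
noncomputable def rate : ℝ := (1 - D.θ) * D.k₃ / (2 * D.k₂)

/-- The ultimate bound `B = (L k₄ / (θ k₃)) √(k₂ / k₁) δ`. -/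
noncomputable def bound (δ : ℝ) : ℝ := D.L * D.k₄ / (D.θ * D.k₃) * √(D.k₂ / D.k₁) * δ

end ThresholdData

end ControlProblem

/-- The pointwise control error `‖û(x) - u*(x)‖`. -/
noncomputable def controlError {n m : ℕ}
    (uhat ustar : EuclideanSpace ℝ (Fin n) → EuclideanSpace ℝ (Fin m))
    (x : EuclideanSpace ℝ (Fin n)) : ℝ := ‖uhat x - ustar x‖

/-- The true maximum error `δ` of the control on the closed ball of radius `r`. -/
noncomputable def maxError {n m : ℕ}
    (uhat ustar : EuclideanSpace ℝ (Fin n) → EuclideanSpace ℝ (Fin m)) (r : ℝ) : ℝ :=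
  sSup (controlError uhat ustar '' Metric.closedBall 0 r)

/-- The empirical maximum error `δ_N` on the test points `x 0, …, x (N - 1)` (for `N ≥ 1`). -/
noncomputable def empiricalError {n m N : ℕ}
    (uhat ustar : EuclideanSpace ℝ (Fin n) → EuclideanSpace ℝ (Fin m))
    (x : Fin N → EuclideanSpace ℝ (Fin n)) : ℝ :=
  ⨆ i, controlError uhat ustar (x i)

/-- `F(δ, ε) = Pr (δ - ‖û(x) - u*(x)‖ > ε)` for `x` distributed according to `μ`. -/
noncomputable def gapProb {n m : ℕ}
    (uhat ustar : EuclideanSpace ℝ (Fin n) → EuclideanSpace ℝ (Fin m))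
    (μ : Measure (EuclideanSpace ℝ (Fin n))) (δ ε : ℝ) : ℝ :=
  μ.real {x | δ - controlError uhat ustar x > ε}

/-- The variant `Pr (δ - ‖û(x) - u*(x)‖ ≥ ε)` of `gapProb` with a weak inequality. -/
noncomputable def weakGapProb {n m : ℕ}
    (uhat ustar : EuclideanSpace ℝ (Fin n) → EuclideanSpace ℝ (Fin m))
    (μ : Measure (EuclideanSpace ℝ (Fin n))) (δ ε : ℝ) : ℝ :=
  μ.real {x | δ - controlError uhat ustar x ≥ ε}

/-!
The error `‖uhat x - ustar x‖` is continuous on the closed ball, so its supremum `δ` is attained.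

*Existence of a threshold.* This amounts to a converse Lyapunov theorem, which is reduced to the
linearization `A` of the optimal closed loop at the origin. Optimality of the feedback provides
trajectories from every initial state, which stay in the ball when started near the origin
(`IsExpStableEquilibrium.exists_solution`). Over a long time `T` they contract by a factor `1/4`,
and by Grönwall's inequality they differ from `e^{tA} x₀` by `o(‖x₀‖)`, so `‖e^{TA}‖ ≤ 1/2`
(`exists_norm_exp_le_half`). Hence `W(x) = ∫₀ᵀ ‖e^{tA} x‖² dt` is a quadratic Lyapunov function of
the linearization (`exists_lyapunov_form`), and of the closed loop itself on a small ball
(`exists_lyapunov_function_of_hasFDerivAt`). The Lipschitz constant in the control exists because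
`f` is `C¹` on a compact convex set.

*Ultimate boundedness.* Under `uhat`, the derivative of `W` along a trajectory is at most
`-k₃ ‖x‖² + k₄ ‖x‖ L δ`, hence at most `-2αW` wherever `‖x‖ ≥ s := L k₄ δ / (θ k₃)`
(`ControlProblem.ThresholdData.fderiv_le`). The condition `δ < δ⁺` says that `k₂ s² < k₁ ρ²`, so a
sublevel set of `W` keeps the trajectory within the ball of radius `ρ`; then `W` decays
exponentially until it reaches the level `k₂ s²`, and stays below that level afterwards
(`exists_time_decay_then_le`).

*Probability.* The empirical maximum misses `δ` by more than `ε` exactly when each of the `N`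
independent test points does, which has probability `F(δ, ε) ^ N`. A maximizer of the error lies in
the support of `μ`, so points near it have positive mass and `F(δ, ε) < 1` (`weakGapProb_lt_one`).
Nothing is known about `ustar` outside the ball, so the events are only null-measurable.
-/

/-! ### Scalar comparison and exit times -/

/-- If `φ` stays below `r` at time `t` as soon as it stayed below `r` before `t`, then it never
reaches `r`: otherwise the first time at which it reaches `r` gives a contradiction. -/
theorem lt_of_forall_prior_lt {φ : ℝ → ℝ} {r : ℝ} (hφ : ContinuousOn φ (Set.Ici 0))
    (hstep : ∀ t, 0 ≤ t → (∀ s, 0 ≤ s → s < t → φ s < r) → φ t < r) :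
    ∀ t, 0 ≤ t → φ t < r := by
  by_contra! hcon
  obtain ⟨t, ht, hrt⟩ := hcon
  set S : Set ℝ := Set.Ici 0 ∩ φ ⁻¹' Set.Ici r with hS
  have hclosed : IsClosed S := hφ.preimage_isClosed_of_isClosed isClosed_Ici isClosed_Ici
  have hbdd : BddBelow S := ⟨0, fun s hs => hs.1⟩
  have hmem : sInf S ∈ S := hclosed.csInf_mem ⟨t, ht, hrt⟩ hbdd
  refine absurd (hstep _ hmem.1 fun s hs hlt => ?_) (not_lt.2 hmem.2)
  by_contra! h
  exact absurd (csInf_le hbdd (show s ∈ S from ⟨hs, h⟩)) (not_le.2 hlt)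

/-- A sublevel set `{v ≤ c}` is not left while `v` decreases on its boundary. -/
theorem le_of_deriv_neg_on_level {v v' : ℝ → ℝ} {a b c : ℝ} (hv : ContinuousOn v (Set.Icc a b))
    (hv' : ∀ t ∈ Set.Ico a b, HasDerivWithinAt v (v' t) (Set.Ici t) t) (ha : v a ≤ c)
    (hneg : ∀ t ∈ Set.Ico a b, v t = c → v' t < 0) : ∀ t ∈ Set.Icc a b, v t ≤ c :=
  image_le_of_deriv_right_lt_deriv_boundary' hv hv' ha continuousOn_const
    (fun _ _ => hasDerivWithinAt_const _ _ _) hneg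

/-- Comparison with the linear equation `v' = -a v`. -/
theorem le_mul_exp_of_deriv_le {v v' : ℝ → ℝ} {a b : ℝ}
    (hv : ContinuousOn v (Set.Icc 0 b))
    (hv' : ∀ t ∈ Set.Ico 0 b, HasDerivWithinAt v (v' t) (Set.Ici t) t)
    (hle : ∀ t ∈ Set.Ico 0 b, v' t ≤ -a * v t) :
    ∀ t ∈ Set.Icc 0 b, v t ≤ v 0 * Real.exp (-a * t) := by
  intro t ht
  have hd : ∀ t : ℝ, HasDerivAt (fun t => Real.exp (a * t)) (Real.exp (a * t) * a) t := fun t => by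
    simpa using ((hasDerivAt_id t).const_mul a).exp
  have key := image_le_of_deriv_right_le_deriv_boundary
    (f := fun t => v t * Real.exp (a * t))
    (f' := fun t => v' t * Real.exp (a * t) + v t * (Real.exp (a * t) * a))
    (B := fun _ => v 0) (B' := fun _ => 0)
    (hv.mul (by fun_prop)) (fun t ht => (hv' t ht).mul (hd t).hasDerivWithinAt) (by simp)
    continuousOn_const (fun _ _ => hasDerivWithinAt_const _ _ _) (fun t ht => by
      have := mul_le_mul_of_nonneg_right (hle t ht) (Real.exp_pos (a * t)).le
      linarith) ht
  calc v t = (v t * Real.exp (a * t)) * Real.exp (-a * t) := by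
        rw [mul_assoc, ← Real.exp_add]; simp
    _ ≤ _ := mul_le_mul_of_nonneg_right key (Real.exp_pos _).le

/-- A function with `v' ≤ -a v` above the level `b > 0` decays exponentially until it
reaches that level, after finite time, and stays below it afterwards. -/
theorem exists_time_decay_then_le {v v' : ℝ → ℝ} {a b : ℝ} (ha : 0 < a) (hb : 0 < b)
    (hv' : ∀ t, 0 ≤ t → HasDerivWithinAt v (v' t) (Set.Ici 0) t)
    (hle : ∀ t, 0 ≤ t → b ≤ v t → v' t ≤ -a * v t) :
    ∃ T, 0 ≤ T ∧ (∀ t, 0 ≤ t → t < T → v t ≤ v 0 * Real.exp (-a * t)) ∧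
      ∀ t, T ≤ t → v t ≤ b := by
  have hcont : ContinuousOn v (Set.Ici 0) := fun t ht => (hv' t ht).continuousWithinAt
  have hright : ∀ t, 0 ≤ t → HasDerivWithinAt v (v' t) (Set.Ici t) t := fun t ht =>
    (hv' t ht).mono (Set.Ici_subset_Ici.2 ht)
  have hIcc : ∀ {s t : ℝ}, 0 ≤ s → ContinuousOn v (Set.Icc s t) := fun hs =>
    hcont.mono fun u hu => hs.trans hu.1
  set S : Set ℝ := Set.Ici 0 ∩ v ⁻¹' Set.Iic b with hS
  have hclosed : IsClosed S := hcont.preimage_isClosed_of_isClosed isClosed_Ici isClosed_Iic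
  have hbdd : BddBelow S := ⟨0, fun s hs => hs.1⟩
  have hdecay : ∀ t, 0 ≤ t → (∀ s, 0 ≤ s → s < t → b < v s) → v t ≤ v 0 * Real.exp (-a * t) :=
    fun t ht hlt => le_mul_exp_of_deriv_le (hIcc le_rfl) (fun s hs => hright s hs.1)
      (fun s hs => hle s hs.1 (hlt s hs.1 hs.2).le) t ⟨ht, le_rfl⟩
  have hne : S.Nonempty := by
    by_contra hempty
    have hall : ∀ s, 0 ≤ s → b < v s := fun s hs => by
      by_contra! h
      exact hempty ⟨s, hs, h⟩
    have hlim : Filter.Tendsto (fun t => v 0 * Real.exp (-a * t)) Filter.atTop (nhds 0) := by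
      have : Filter.Tendsto (fun t => Real.exp (-(a * t))) Filter.atTop (nhds 0) :=
        Real.tendsto_exp_neg_atTop_nhds_zero.comp (Filter.tendsto_id.const_mul_atTop ha)
      simpa using this.const_mul (v 0)
    obtain ⟨t, ht, hlt⟩ :=
      ((Filter.eventually_ge_atTop 0).and (hlim.eventually_lt_const hb)).exists
    exact absurd (hdecay t ht fun s hs _ => hall s hs) (not_le.2 (hlt.trans (hall t ht)))
  have hmem : sInf S ∈ S := hclosed.csInf_mem hne hbdd
  refine ⟨sInf S, hmem.1, fun t ht hlt => hdecay t ht fun s hs hst => ?_, fun t ht => ?_⟩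
  · by_contra! h
    exact absurd (csInf_le hbdd (show s ∈ S from ⟨hs, h⟩)) (not_le.2 (hst.trans hlt))
  · refine le_of_deriv_neg_on_level (hIcc hmem.1) (fun s hs => hright s (hmem.1.trans hs.1)) hmem.2
      (fun s hs hvs => (hle s (hmem.1.trans hs.1) hvs.ge).trans_lt ?_) t ⟨ht, le_rfl⟩
    rw [hvs]
    nlinarith

/-! ### Converse Lyapunov theorem by linearization -/

/-- If `‖e^{TA}‖ ≤ 1/2` for some `T > 0`, then `Q = ∫₀ᵀ (e^{tA})* e^{tA} dt` is a quadratic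
Lyapunov form of `x' = Ax`: the derivative of `⟪Qx, x⟫` along the flow is
`‖e^{TA} x‖² - ‖x‖²`. -/
theorem exists_lyapunov_form {E : Type*} [NormedAddCommGroup E] [InnerProductSpace ℝ E]
    [CompleteSpace E] (A : E →L[ℝ] E) {T : ℝ} (hT : 0 < T)
    (hA : ‖NormedSpace.exp (T • A)‖ ≤ 1 / 2) :
    ∃ Q : E →L[ℝ] E, (∀ x y, inner ℝ (Q x) y = inner ℝ (Q y) x) ∧
      (∃ c, 0 < c ∧ ∀ x, c * ‖x‖ ^ 2 ≤ inner ℝ (Q x) x) ∧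
      ∀ x, 2 * inner ℝ (Q x) (A x) ≤ -(3 / 4) * ‖x‖ ^ 2 := by
  set e : ℝ → E →L[ℝ] E := fun t => NormedSpace.exp (t • A) with he
  have hederiv : ∀ t, HasDerivAt e (e t * A) t := fun t => hasDerivAt_exp_smul_const A t
  have hecont : Continuous e := continuous_iff_continuousAt.2 fun t => (hederiv t).continuousAt
  have hinv : ∀ t, e (-t) * e t = 1 := fun t => by
    simp only [he, neg_smul]
    let _ : NormedAlgebra ℚ (E →L[ℝ] E) := NormedAlgebra.restrictScalars ℚ ℝ (E →L[ℝ] E)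
    rw [← NormedSpace.exp_add_of_commute (Commute.refl (t • A)).neg_left]
    simp
  have he0 : e 0 = 1 := by simp [he]
  set G : ℝ → E →L[ℝ] E := fun t => (ContinuousLinearMap.adjoint (e t)).comp (e t) with hG
  have hGcont : Continuous G :=
    (ContinuousLinearMap.adjoint.continuous.comp hecont).clm_comp hecont
  have hQ : ∀ x y, inner ℝ ((∫ t in (0 : ℝ)..T, G t) x) y
      = ∫ t in (0 : ℝ)..T, inner ℝ (e t x) (e t y) := fun x y => by
    have h1 : ((innerSL ℝ y).comp (ContinuousLinearMap.apply ℝ E x)) (∫ t in (0 : ℝ)..T, G t)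
        = ∫ t in (0 : ℝ)..T, ((innerSL ℝ y).comp (ContinuousLinearMap.apply ℝ E x)) (G t) :=
      (ContinuousLinearMap.intervalIntegral_comp_comm _ (hGcont.intervalIntegrable _ _)).symm
    rw [real_inner_comm]
    refine h1.trans (intervalIntegral.integral_congr fun t _ => ?_)
    simp [hG, ContinuousLinearMap.adjoint_inner_right, real_inner_comm]
  refine ⟨∫ t in (0 : ℝ)..T, G t, fun x y => ?_, ?_, fun x => ?_⟩
  · rw [hQ, hQ]
    exact intervalIntegral.integral_congr fun t _ => real_inner_comm _ _
  · obtain ⟨M, hM⟩ := (isCompact_Icc (a := (0 : ℝ)) (b := T)).exists_bound_of_continuousOn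
      (hecont.comp continuous_neg).continuousOn
    have hM' : (0 : ℝ) < M ^ 2 + 1 := by positivity
    refine ⟨T / (M ^ 2 + 1), by positivity, fun x => ?_⟩
    have hpt : ∀ t ∈ Set.Icc 0 T, ‖x‖ ^ 2 / (M ^ 2 + 1) ≤ inner ℝ (e t x) (e t x) := by
      intro t ht
      rw [real_inner_self_eq_norm_sq, div_le_iff₀ hM']
      have h1 : ‖x‖ ≤ M * ‖e t x‖ := by
        calc ‖x‖ = ‖e (-t) (e t x)‖ := by
              rw [← mul_apply_eq_comp, hinv]; rfl
          _ ≤ ‖e (-t)‖ * ‖e t x‖ := ContinuousLinearMap.le_opNorm _ _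
          _ ≤ M * ‖e t x‖ := mul_le_mul_of_nonneg_right (hM t ht) (norm_nonneg _)
      have h2 := pow_le_pow_left₀ (norm_nonneg x) h1 2
      nlinarith [sq_nonneg ‖e t x‖]
    rw [hQ]
    have h3 := intervalIntegral.integral_mono_on (μ := volume) hT.le
      (intervalIntegrable_const (c := ‖x‖ ^ 2 / (M ^ 2 + 1)))
      (Continuous.intervalIntegrable (by fun_prop) 0 T) hpt
    simp only [intervalIntegral.integral_const, sub_zero, smul_eq_mul] at h3
    calc _ = T * (‖x‖ ^ 2 / (M ^ 2 + 1)) := by ring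
      _ ≤ _ := h3
  · rw [hQ, ← intervalIntegral.integral_const_mul]
    have hd : ∀ t ∈ Set.uIcc 0 T, HasDerivAt (fun t => ‖e t x‖ ^ 2)
        (2 * inner ℝ (e t x) (e t (A x))) t := fun t _ => by
      have h1 : HasDerivAt (fun t => e t x) (e t (A x)) t := by
        simpa using (hederiv t).clm_apply (hasDerivAt_const t x)
      exact h1.norm_sq
    rw [intervalIntegral.integral_eq_sub_of_hasDerivAt hd
      (Continuous.intervalIntegrable (by fun_prop) 0 T), he0]
    have h2 : ‖e T x‖ ≤ 1 / 2 * ‖x‖ := (e T).le_of_opNorm_le hA x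
    have h3 := pow_le_pow_left₀ (norm_nonneg _) h2 2
    rw [show (1 : E →L[ℝ] E) x = x from rfl]
    linarith

/-- A quadratic Lyapunov form of the linearization `A = g'(0)` is a Lyapunov function of
`x' = g(x)` near the origin, as `g(x) - Ax` is small compared to `‖x‖`. -/
theorem exists_lyapunov_function_of_hasFDerivAt {E : Type*} [NormedAddCommGroup E]
    [InnerProductSpace ℝ E] {g : E → E} {A Q : E →L[ℝ] E}
    (hg0 : g 0 = 0) (hg : HasFDerivAt g A 0) (hQ : ∀ x y, inner ℝ (Q x) y = inner ℝ (Q y) x)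
    (hQA : ∀ x, 2 * inner ℝ (Q x) (A x) ≤ -(3 / 4) * ‖x‖ ^ 2) {r : ℝ} (hr : 0 < r) :
    ∃ ρ, 0 < ρ ∧ ρ ≤ r ∧ ∃ W : E → ℝ, ContDiff ℝ 1 W ∧ (∀ x, W x = inner ℝ (Q x) x) ∧
      (∀ x, W x ≤ (‖Q‖ + 1) * ‖x‖ ^ 2) ∧ (∀ x, ‖fderiv ℝ W x‖ ≤ (2 * ‖Q‖ + 1) * ‖x‖) ∧
      ∀ x ∈ Metric.ball (0 : E) ρ, fderiv ℝ W x (g x) ≤ -(1 / 2) * ‖x‖ ^ 2 := by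
  have hfd : ∀ x, HasFDerivAt (fun x => inner ℝ (Q x) x) (2 • innerSL ℝ (Q x)) x := fun x => by
    refine (Q.hasFDerivAt.inner ℝ (hasFDerivAt_id x)).congr_fderiv ?_
    ext y
    simp [hQ y x, two_smul]
  have hη : (0 : ℝ) < 1 / (4 * (2 * ‖Q‖ + 1)) := by positivity
  obtain ⟨ρ₀, hρ₀, hball⟩ := Metric.eventually_nhds_iff_ball.1 (hg.isLittleO.def hη)
  refine ⟨min ρ₀ r, lt_min hρ₀ hr, min_le_right _ _, fun x => inner ℝ (Q x) x,
    Q.contDiff.inner ℝ contDiff_id, fun _ => rfl, fun x => ?_, fun x => ?_, fun x hx => ?_⟩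
  · calc inner ℝ (Q x) x ≤ ‖Q x‖ * ‖x‖ := real_inner_le_norm _ _
      _ ≤ ‖Q‖ * ‖x‖ * ‖x‖ := by gcongr; exact Q.le_opNorm x
      _ ≤ _ := by nlinarith [sq_nonneg ‖x‖]
  · rw [(hfd x).fderiv, two_smul]
    refine (norm_add_le _ _).trans ?_
    rw [innerSL_apply_norm]
    have := Q.le_opNorm x
    nlinarith [norm_nonneg x]
  · have h1 := hball x (Metric.ball_subset_ball (min_le_left _ _) hx)
    simp only [sub_zero, hg0] at h1
    have h2 : inner ℝ (Q x) (g x - A x) ≤ ‖Q‖ * ‖x‖ * (1 / (4 * (2 * ‖Q‖ + 1)) * ‖x‖) :=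
      (real_inner_le_norm _ _).trans
        (mul_le_mul (Q.le_opNorm x) h1 (norm_nonneg _) (by positivity))
    have h3 : 2 * (‖Q‖ * ‖x‖ * (1 / (4 * (2 * ‖Q‖ + 1)) * ‖x‖)) ≤ 1 / 4 * ‖x‖ ^ 2 := by
      have h4 : 2 * (‖Q‖ * ‖x‖ * (1 / (4 * (2 * ‖Q‖ + 1)) * ‖x‖))
          = (2 * ‖Q‖ / (2 * ‖Q‖ + 1)) * (1 / 4 * ‖x‖ ^ 2) := by
        field_simp
      rw [h4]
      refine mul_le_of_le_one_left (by positivity) ?_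
      rw [div_le_one (by positivity)]
      linarith
    rw [(hfd x).fderiv, two_smul]
    have h5 : inner ℝ (Q x) (g x) = inner ℝ (Q x) (A x) + inner ℝ (Q x) (g x - A x) := by
      rw [← inner_add_right]; simp
    have h6 := hQA x
    change inner ℝ (Q x) (g x) + inner ℝ (Q x) (g x) ≤ _
    linarith

theorem opNorm_le_half_of_eventually {E : Type*} [NormedAddCommGroup E] [NormedSpace ℝ E]
    {B : E →L[ℝ] E} (h : ∀ᶠ x in nhds (0 : E), ‖B x‖ ≤ 1 / 2 * ‖x‖) : ‖B‖ ≤ 1 / 2 := by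
  obtain ⟨ε, hε, hball⟩ := Metric.eventually_nhds_iff_ball.1 h
  refine B.opNorm_le_of_ball hε (by norm_num) fun x hx => hball x hx

theorem gronwallBound_zero_left (K ε x : ℝ) :
    gronwallBound 0 K ε x = ε * gronwallBound 0 K 1 x := by
  unfold gronwallBound
  split_ifs <;> ring

/-- A solution of the integral equation in a ball where `g` is continuous is a classical
solution. -/
theorem isSolutionOn_of_integral_eq {n : ℕ}
    {g : EuclideanSpace ℝ (Fin n) → EuclideanSpace ℝ (Fin n)} {r : ℝ}
    (hg : ContinuousOn g (Metric.closedBall 0 r)) {x : ℝ → EuclideanSpace ℝ (Fin n)}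
    {x₀ : EuclideanSpace ℝ (Fin n)} {T : ℝ} (hx : ContinuousOn x (Set.Icc 0 T))
    (hint : ∀ t ∈ Set.Icc 0 T, x t = x₀ + ∫ s in (0 : ℝ)..t, g (x s))
    (hball : ∀ t ∈ Set.Icc 0 T, ‖x t‖ ≤ r) : IsSolutionOn g x (Set.Icc 0 T) := by
  intro t ht
  have hgx : ContinuousOn (fun s => g (x s)) (Set.Icc 0 T) :=
    hg.comp hx fun s hs => by simpa using hball s hs
  have : Fact (t ∈ Set.Icc 0 T) := ⟨ht⟩
  have hd : HasDerivWithinAt (fun u => ∫ s in (0 : ℝ)..u, g (x s)) (g (x t)) (Set.Icc 0 T) t :=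
    intervalIntegral.integral_hasDerivWithinAt_right
      ((hgx.mono (by rw [Set.uIcc_of_le ht.1]; exact Set.Icc_subset_Icc_right ht.2)).intervalIntegrable)
      (hgx.stronglyMeasurableAtFilter_nhdsWithin measurableSet_Icc t) (hgx t ht)
  exact (hd.const_add x₀).congr hint (hint t ht)

/-- Exponential stability as defined only bounds classical solutions, while the given ones satisfy
the integral equation. Near the origin the two notions agree: as long as a solution remains in the
ball of radius `r`, where `g` is continuous, it is classical, and then the decay estimate keeps it
there. -/
theorem IsExpStableEquilibrium.exists_solution {n : ℕ}
    {g : EuclideanSpace ℝ (Fin n) → EuclideanSpace ℝ (Fin n)} (hexp : IsExpStableEquilibrium g)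
    {r : ℝ} (hr : 0 < r) (hg : ContinuousOn g (Metric.closedBall 0 r))
    (hsol : ∀ x₀, ∃ x : ℝ → EuclideanSpace ℝ (Fin n), ContinuousOn x (Set.Ici 0) ∧
      ∀ t, 0 ≤ t → x t = x₀ + ∫ s in (0 : ℝ)..t, g (x s)) :
    ∃ k lam : ℝ, 0 < k ∧ 0 < lam ∧ ∀ᶠ x₀ in nhds (0 : EuclideanSpace ℝ (Fin n)), ∀ T, 0 < T →
      ∃ x : ℝ → EuclideanSpace ℝ (Fin n), x 0 = x₀ ∧ IsSolutionOn g x (Set.Icc 0 T) ∧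
        ∀ t ∈ Set.Icc 0 T, ‖x t‖ ≤ k * ‖x₀‖ * Real.exp (-lam * t) := by
  obtain ⟨-, c, k, lam, hc, hk, hlam, hdecay⟩ := hexp
  refine ⟨k, lam, hk, hlam, ?_⟩
  have hnorm : Filter.Tendsto (fun x : EuclideanSpace ℝ (Fin n) => ‖x‖) (nhds 0) (nhds 0) := by
    simpa using (continuous_norm (E := EuclideanSpace ℝ (Fin n))).tendsto 0
  have hknorm : Filter.Tendsto (fun x : EuclideanSpace ℝ (Fin n) => k * ‖x‖) (nhds 0) (nhds 0) := by
    simpa using hnorm.const_mul k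
  filter_upwards [hnorm.eventually_lt_const hc, hnorm.eventually_lt_const hr,
    hknorm.eventually_lt_const hr] with x₀ h1 h2 h3 T hT
  obtain ⟨x, hx, hint⟩ := hsol x₀
  have hx0 : x 0 = x₀ := by simpa using hint 0 le_rfl
  have hsolve : ∀ t, 0 < t → (∀ s ∈ Set.Icc 0 t, ‖x s‖ ≤ r) → IsSolutionOn g x (Set.Icc 0 t) :=
    fun t _ hb => isSolutionOn_of_integral_eq hg (hx.mono Set.Icc_subset_Ici_self)
      (fun s hs => hint s hs.1) hb
  have hexpdecay : ∀ t, 0 < t → (∀ s ∈ Set.Icc 0 t, ‖x s‖ ≤ r) →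
      ∀ s ∈ Set.Icc 0 t, ‖x s‖ ≤ k * ‖x₀‖ * Real.exp (-lam * s) := fun t ht hb => by
    have := hdecay t x ht (hsolve t ht hb) (by rwa [hx0])
    rwa [hx0] at this
  have hstay : ∀ t, 0 ≤ t → ‖x t‖ < r := by
    refine lt_of_forall_prior_lt hx.norm fun t ht hprior => ?_
    rcases ht.eq_or_lt with rfl | ht'
    · rwa [hx0]
    · have hb : ∀ s ∈ Set.Icc 0 t, ‖x s‖ ≤ r := by
        have hcl : closure (Set.Ico 0 t) = Set.Icc 0 t := closure_Ico ht'.ne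
        intro s hs
        have hcont : ContinuousOn (fun s => ‖x s‖) (closure (Set.Ico 0 t)) := by
          rw [hcl]; exact hx.norm.mono Set.Icc_subset_Ici_self
        exact le_on_closure (fun u hu => (hprior u hu.1 hu.2).le) hcont continuousOn_const
          (by rwa [hcl])
      refine (hexpdecay t ht' hb t ⟨ht, le_rfl⟩).trans_lt (lt_of_le_of_lt ?_ h3)
      refine mul_le_of_le_one_right (by positivity) (Real.exp_le_one_iff.2 ?_)
      nlinarith
  exact ⟨x, hx0, hsolve T hT fun s hs => (hstay s hs.1).le,
    hexpdecay T hT fun s hs => (hstay s hs.1).le⟩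

/-- Exponential stability passes to the linearization: for a suitable `T`, the flow of `g` over
time `T` contracts short vectors by a factor `1/4`, and it differs from `e^{TA}` by `o(‖x‖)`
(Grönwall), so `e^{TA}` contracts by a factor `1/2`. -/
theorem exists_norm_exp_le_half {n : ℕ}
    {g : EuclideanSpace ℝ (Fin n) → EuclideanSpace ℝ (Fin n)}
    {A : EuclideanSpace ℝ (Fin n) →L[ℝ] EuclideanSpace ℝ (Fin n)}
    (hg0 : g 0 = 0) (hA : HasFDerivAt g A 0) {k lam : ℝ} (hk : 0 < k) (hlam : 0 < lam)
    (hsol : ∀ᶠ x₀ in nhds (0 : EuclideanSpace ℝ (Fin n)), ∀ T, 0 < T →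
      ∃ x : ℝ → EuclideanSpace ℝ (Fin n), x 0 = x₀ ∧ IsSolutionOn g x (Set.Icc 0 T) ∧
        ∀ t ∈ Set.Icc 0 T, ‖x t‖ ≤ k * ‖x₀‖ * Real.exp (-lam * t)) :
    ∃ T : ℝ, 0 < T ∧ ‖NormedSpace.exp (T • A)‖ ≤ 1 / 2 := by
  obtain ⟨T, hT, hTk⟩ : ∃ T : ℝ, 0 < T ∧ k * Real.exp (-lam * T) < 1 / 4 := by
    have hlim : Filter.Tendsto (fun t => k * Real.exp (-lam * t)) Filter.atTop (nhds 0) := by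
      have : Filter.Tendsto (fun t => Real.exp (-(lam * t))) Filter.atTop (nhds 0) :=
        Real.tendsto_exp_neg_atTop_nhds_zero.comp (Filter.tendsto_id.const_mul_atTop hlam)
      simpa using this.const_mul k
    exact ((Filter.eventually_gt_atTop 0).and
      (hlim.eventually_lt_const (by norm_num : (0 : ℝ) < 1 / 4))).exists
  refine ⟨T, hT, opNorm_le_half_of_eventually ?_⟩
  -- `η` makes the Grönwall error `η k ‖x₀‖ C` at most `‖x₀‖ / 4`.
  set C := gronwallBound 0 ‖A‖ 1 T with hC
  obtain ⟨η, hη, hηC⟩ : ∃ η : ℝ, 0 < η ∧ η * k * C ≤ 1 / 4 := by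
    refine ⟨1 / (4 * k * (|C| + 1)), by positivity, ?_⟩
    have h1 : 1 / (4 * k * (|C| + 1)) * k * C = C / (|C| + 1) * (1 / 4) := by
      field_simp
    rw [h1]
    refine mul_le_of_le_one_left (by norm_num) ?_
    rw [div_le_one (by positivity)]
    linarith [le_abs_self C]
  obtain ⟨ρ, hρ, hball⟩ := Metric.eventually_nhds_iff_ball.1 (hA.isLittleO.def hη)
  have hknorm : Filter.Tendsto (fun x : EuclideanSpace ℝ (Fin n) => k * ‖x‖) (nhds 0) (nhds 0) := by
    simpa using (continuous_norm (E := EuclideanSpace ℝ (Fin n))).tendsto 0 |>.const_mul k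
  filter_upwards [hsol, hknorm.eventually_lt_const hρ] with x₀ hx₀ hsmall
  obtain ⟨x, hx0, hxsol, hxdecay⟩ := hx₀ T hT
  have hxle : ∀ t ∈ Set.Icc 0 T, ‖x t‖ ≤ k * ‖x₀‖ := fun t ht =>
    (hxdecay t ht).trans (mul_le_of_le_one_right (by positivity)
      (Real.exp_le_one_iff.2 (by nlinarith [ht.1])))
  have hy : ∀ t, HasDerivAt (fun t : ℝ => NormedSpace.exp (t • A) x₀)
      (A (NormedSpace.exp (t • A) x₀)) t := fun t => by
    simpa using (hasDerivAt_exp_smul_const' A t).clm_apply (hasDerivAt_const t x₀)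
  have hgr := norm_le_gronwallBound_of_norm_deriv_right_le (a := 0) (b := T) (δ := 0) (K := ‖A‖)
    (ε := η * (k * ‖x₀‖))
    (f := fun t => x t - NormedSpace.exp (t • A) x₀)
    (f' := fun t => g (x t) - A (NormedSpace.exp (t • A) x₀))
    (fun t ht => ((hxsol t ht).sub (hy t).hasDerivWithinAt).continuousWithinAt)
    (fun t ht => by
      have h1 := ((hxsol t ⟨ht.1, ht.2.le⟩).sub (hy t).hasDerivWithinAt)
      exact h1.mono_of_mem_nhdsWithin
        (Filter.mem_of_superset (Icc_mem_nhdsGE ht.2) (Set.Icc_subset_Icc_left ht.1)))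
    (by
      have h0 : (0 : ℝ) • A = 0 := zero_smul ℝ A
      change ‖x 0 - NormedSpace.exp ((0 : ℝ) • A) x₀‖ ≤ 0
      rw [hx0, h0, NormedSpace.exp_zero, one_apply_eq_self, sub_self, norm_zero])
    (fun t ht => by
      have ht' : t ∈ Set.Icc 0 T := ⟨ht.1, ht.2.le⟩
      have h1 := hball (x t) (by simpa using (hxle t ht').trans_lt hsmall)
      simp only [sub_zero, hg0] at h1
      have h2 : g (x t) - A (NormedSpace.exp (t • A) x₀)
          = A (x t - NormedSpace.exp (t • A) x₀) + (g (x t) - A (x t)) := by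
        rw [map_sub]; abel
      rw [h2]
      refine (norm_add_le _ _).trans (add_le_add (A.le_opNorm _) (h1.trans ?_))
      exact mul_le_mul_of_nonneg_left (hxle t ht') hη.le)
    T ⟨hT.le, le_rfl⟩
  rw [sub_zero, gronwallBound_zero_left, ← hC] at hgr
  have hxT := hxdecay T ⟨hT.le, le_rfl⟩
  have h3 : ‖NormedSpace.exp (T • A) x₀‖ ≤ ‖x T‖ + ‖x T - NormedSpace.exp (T • A) x₀‖ := by
    have := norm_sub_le (x T) (x T - NormedSpace.exp (T • A) x₀)
    rwa [sub_sub_cancel] at this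
  have h4 : k * ‖x₀‖ * Real.exp (-lam * T) ≤ 1 / 4 * ‖x₀‖ := by
    nlinarith [norm_nonneg x₀]
  have h5 : η * (k * ‖x₀‖) * C ≤ 1 / 4 * ‖x₀‖ := by
    nlinarith [norm_nonneg x₀]
  linarith

namespace ControlProblem

variable {n m : ℕ} (P : ControlProblem n m)

/-! ### Existence of thresholds -/

theorem convex_U : Convex ℝ P.U := by
  have : P.U = ⋂ i, (EuclideanSpace.proj (𝕜 := ℝ) i) ⁻¹' Set.Icc (P.umin i) (P.umax i) := by
    ext u; simp [U]
  rw [this]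
  exact convex_iInter fun i => (convex_Icc _ _).linear_preimage
    (EuclideanSpace.proj (𝕜 := ℝ) i).toLinearMap

theorem isCompact_U : IsCompact P.U := by
  have : P.U = (EuclideanSpace.equiv (Fin m) ℝ).toHomeomorph ⁻¹'
      Set.Icc P.umin.ofLp P.umax.ofLp := by
    ext u; simp [U, Pi.le_def, forall_and]
  rw [this, Homeomorph.isCompact_preimage]
  exact isCompact_Icc

/-- A `C¹` map on a convex set is locally Lipschitz, hence Lipschitz on compact subsets. -/
theorem exists_lipschitz_control (r : ℝ) :
    ∃ L, 0 < L ∧ ∀ x ∈ Metric.closedBall (0 : EuclideanSpace ℝ (Fin n)) r, ∀ u ∈ P.U, ∀ v ∈ P.U,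
      ‖P.f x u - P.f x v‖ ≤ L * ‖u - v‖ := by
  set F : EuclideanSpace ℝ (Fin n) × EuclideanSpace ℝ (Fin m) → EuclideanSpace ℝ (Fin n) :=
    fun p => P.f p.1 p.2
  have hloc : LocallyLipschitzOn (Set.univ ×ˢ P.U) F := fun p hp =>
    (P.contDiffOn_f p hp).exists_lipschitzOnWith (convex_univ.prod P.convex_U)
  obtain ⟨K, hK⟩ := (hloc.mono (Set.prod_mono (Set.subset_univ
    (Metric.closedBall (0 : EuclideanSpace ℝ (Fin n)) r)) subset_rfl)).exists_lipschitzOnWith_of_compact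
      ((isCompact_closedBall _ _).prod P.isCompact_U)
  refine ⟨K + 1, by positivity, fun x hx u hu v hv => ?_⟩
  have h := hK.dist_le_mul (x, u) ⟨hx, hu⟩ (x, v) ⟨hx, hv⟩
  simp only [F, dist_eq_norm, Prod.mk_sub_mk, sub_self, Prod.norm_mk, norm_zero] at h
  rw [max_eq_right (norm_nonneg _)] at h
  nlinarith [norm_nonneg (u - v)]

/-- The optimal feedback generates trajectories from every initial state, so exponential stability
yields a Lyapunov function of quadratic type by linearization. -/
theorem nonempty_thresholdData {ustar : EuclideanSpace ℝ (Fin n) → EuclideanSpace ℝ (Fin m)}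
    (hopt : P.IsOptimalFeedback ustar) {r : ℝ} (hr : 0 < r)
    (hdiff : DifferentiableOn ℝ (P.closedLoop ustar) (Metric.closedBall 0 r))
    (hexp : IsExpStableEquilibrium (P.closedLoop ustar)) :
    Nonempty (P.ThresholdData ustar r) := by
  obtain ⟨k, lam, hk, hlam, hsol⟩ := hexp.exists_solution hr hdiff.continuousOn fun x₀ => by
    obtain ⟨x, hx, -⟩ := hopt.2 x₀
    exact ⟨x, hx.2.2.1, hx.2.2.2⟩
  have hA := (hdiff.differentiableAt (Metric.closedBall_mem_nhds 0 hr)).hasFDerivAt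
  obtain ⟨T, hT, hTA⟩ := exists_norm_exp_le_half hexp.1 hA hk hlam hsol
  obtain ⟨Q, hsymm, ⟨c, hc, hlower⟩, hQA⟩ := exists_lyapunov_form _ hT hTA
  obtain ⟨ρ, hρ, hρr, W, hW, hWQ, hupper, hgrad, hdecr⟩ :=
    exists_lyapunov_function_of_hasFDerivAt hexp.1 hA hsymm hQA hr
  obtain ⟨L, hL, hLip⟩ := P.exists_lipschitz_control r
  exact ⟨{
    ρ := ρ, W := W, k₁ := c, k₂ := ‖Q‖ + 1, k₃ := 1 / 2, k₄ := 2 * ‖Q‖ + 1, L := L, θ := 1 / 2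
    ρ_pos := hρ
    ρ_le := hρr
    k₁_pos := hc
    k₂_pos := by positivity
    k₃_pos := by norm_num
    k₄_pos := by positivity
    L_pos := hL
    θ_pos := by norm_num
    θ_lt_one := by norm_num
    contDiffOn_W := hW.contDiffOn
    lower := fun x _ => (hlower x).trans_eq (hWQ x).symm
    upper := fun x _ => hupper x
    decrease := hdecr
    gradient := fun x _ => hgrad x
    lipschitz := fun x hx => hLip x
      (Metric.ball_subset_closedBall (Metric.ball_subset_ball hρr hx)) }⟩

/-! ### Ultimate boundedness -/

namespace ThresholdData

variable {P} {ustar uhat : EuclideanSpace ℝ (Fin n) → EuclideanSpace ℝ (Fin m)} {r : ℝ}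
  (D : P.ThresholdData ustar r)

/-- The radius `L k₄ δ / (θ k₃)` outside which the Lyapunov function decreases despite a control
error of size `δ`. -/
noncomputable def deadRadius (δ : ℝ) : ℝ := D.L * D.k₄ * δ / (D.θ * D.k₃)

theorem bound_eq (δ : ℝ) : D.bound δ = D.gain * D.deadRadius δ := by
  unfold bound gain deadRadius
  ring

theorem deadRadius_nonneg {δ : ℝ} (hδ : 0 ≤ δ) : 0 ≤ D.deadRadius δ := by
  have := D.L_pos; have := D.k₄_pos; have := D.θ_pos; have := D.k₃_pos
  unfold deadRadius; positivity

theorem deadRadius_pos {δ : ℝ} (hδ : 0 < δ) : 0 < D.deadRadius δ := by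
  have := D.L_pos; have := D.k₄_pos; have := D.θ_pos; have := D.k₃_pos
  unfold deadRadius; positivity

theorem rate_pos : 0 < D.rate := by
  have := D.k₂_pos; have := D.k₃_pos; have := sub_pos.2 D.θ_lt_one
  unfold rate; positivity

/-- `k₂ s² < k₁ ρ²` for `0 ≤ s < ρ √(k₁ / k₂)`. -/
theorem k₂_mul_sq_lt {s : ℝ} (hs : 0 ≤ s) (h : s < D.ρ * √(D.k₁ / D.k₂)) :
    D.k₂ * s ^ 2 < D.k₁ * D.ρ ^ 2 := by
  have hk₁ := D.k₁_pos; have hk₂ := D.k₂_pos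
  have h1 := pow_lt_pow_left₀ h hs two_ne_zero
  rw [mul_pow, Real.sq_sqrt (by positivity)] at h1
  calc D.k₂ * s ^ 2 < D.k₂ * (D.ρ ^ 2 * (D.k₁ / D.k₂)) := by gcongr
    _ = _ := by field_simp

theorem deadRadius_lt {δ : ℝ} (h : δ < D.deltaPlus) :
    D.deadRadius δ < D.ρ * √(D.k₁ / D.k₂) := by
  have := D.L_pos; have := D.k₄_pos; have := D.θ_pos; have := D.k₃_pos
  unfold deadRadius
  rw [div_lt_iff₀ (by positivity)]
  calc D.L * D.k₄ * δ < D.L * D.k₄ * D.deltaPlus := by gcongr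
    _ = _ := by unfold deltaPlus; field_simp

/-- From `k₁ ‖x‖² ≤ k₂ s²` to `‖x‖ ≤ √(k₂ / k₁) s`. -/
theorem le_gain_mul {a s : ℝ} (hs : 0 ≤ s) (h : D.k₁ * a ^ 2 ≤ D.k₂ * s ^ 2) :
    a ≤ D.gain * s := by
  have hk₁ := D.k₁_pos; have hk₂ := D.k₂_pos
  refine le_of_sq_le_sq ?_ (mul_nonneg (Real.sqrt_nonneg _) hs)
  rw [gain, mul_pow, Real.sq_sqrt (by positivity), div_mul_eq_mul_div, le_div_iff₀ hk₁]
  linarith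

/-- Along the closed loop under `uhat`, the Lyapunov function decays at the rate `2α` wherever its
value is at least `k₂ s²`, for `s` the radius `L k₄ δ / (θ k₃)`: there `‖x‖ ≥ s`, and the control
error costs at most the fraction `θ` of the decrease `k₃ ‖x‖²`. -/
theorem fderiv_le (huhat : ∀ x, uhat x ∈ P.U) (hustar : ∀ x, ustar x ∈ P.U) {δ : ℝ}
    {x : EuclideanSpace ℝ (Fin n)} (hx : x ∈ Metric.ball 0 D.ρ)
    (herr : ‖uhat x - ustar x‖ ≤ δ) (hlevel : D.k₂ * D.deadRadius δ ^ 2 ≤ D.W x) :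
    fderiv ℝ D.W x (P.closedLoop uhat x) ≤ -(2 * D.rate) * D.W x := by
  have hk₂ := D.k₂_pos; have hk₃ := D.k₃_pos; have hk₄ := D.k₄_pos; have hL := D.L_pos
  have hθ := D.θ_pos
  have hup := D.upper x hx
  have hs : D.deadRadius δ ≤ ‖x‖ := by
    have h1 : D.deadRadius δ ^ 2 ≤ ‖x‖ ^ 2 := le_of_mul_le_mul_left (hlevel.trans hup) hk₂
    exact le_of_sq_le_sq h1 (norm_nonneg _)
  have hLδ : D.L * D.k₄ * δ ≤ D.θ * D.k₃ * ‖x‖ := by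
    rw [deadRadius, div_le_iff₀ (by positivity)] at hs
    linarith
  have hpert : fderiv ℝ D.W x (P.f x (uhat x) - P.f x (ustar x)) ≤ D.θ * D.k₃ * ‖x‖ ^ 2 := by
    calc fderiv ℝ D.W x (P.f x (uhat x) - P.f x (ustar x))
        ≤ ‖fderiv ℝ D.W x (P.f x (uhat x) - P.f x (ustar x))‖ := Real.le_norm_self _
      _ ≤ ‖fderiv ℝ D.W x‖ * ‖P.f x (uhat x) - P.f x (ustar x)‖ :=
          ContinuousLinearMap.le_opNorm _ _
      _ ≤ (D.k₄ * ‖x‖) * (D.L * δ) := by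
          refine mul_le_mul (D.gradient x hx) ?_ (norm_nonneg _) (by positivity)
          exact (D.lipschitz x hx _ (huhat x) _ (hustar x)).trans (by gcongr)
      _ = (D.L * D.k₄ * δ) * ‖x‖ := by ring
      _ ≤ (D.θ * D.k₃ * ‖x‖) * ‖x‖ := by gcongr
      _ = _ := by ring
  have hdec : fderiv ℝ D.W x (P.f x (ustar x)) ≤ -D.k₃ * ‖x‖ ^ 2 := D.decrease x hx
  have hsplit : fderiv ℝ D.W x (P.closedLoop uhat x) = fderiv ℝ D.W x (P.f x (ustar x))
      + fderiv ℝ D.W x (P.f x (uhat x) - P.f x (ustar x)) := by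
    rw [← map_add, add_sub_cancel, closedLoop]
  have hrate : 2 * D.rate * D.W x ≤ (1 - D.θ) * D.k₃ * ‖x‖ ^ 2 := by
    calc 2 * D.rate * D.W x ≤ 2 * D.rate * (D.k₂ * ‖x‖ ^ 2) := by
          have := D.rate_pos; gcongr
      _ = _ := by unfold rate; field_simp
  rw [hsplit]
  linarith

theorem hasDerivWithinAt_W {x : ℝ → EuclideanSpace ℝ (Fin n)} {s : Set ℝ}
    {g : EuclideanSpace ℝ (Fin n) → EuclideanSpace ℝ (Fin n)} (hsol : IsSolutionOn g x s)
    {t : ℝ} (ht : t ∈ s) (hx : x t ∈ Metric.ball 0 D.ρ) :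
    HasDerivWithinAt (fun t => D.W (x t)) (fderiv ℝ D.W (x t) (g (x t))) s t :=
  ((((D.contDiffOn_W.contDiffAt (Metric.isOpen_ball.mem_nhds hx)).differentiableAt
    one_ne_zero).hasFDerivAt).comp_hasDerivWithinAt t (hsol t ht))

/-- The ball of admissible initial values lies in the ball of radius `ρ`: if the latter contains a
nonzero point, then `k₁ ≤ k₂`. -/
theorem norm_lt_of_norm_lt_mul {x : EuclideanSpace ℝ (Fin n)}
    (hx : ‖x‖ < D.ρ * √(D.k₁ / D.k₂)) : ‖x‖ < D.ρ := by
  have hk₂ := D.k₂_pos; have hρ := D.ρ_pos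
  by_contra! h
  have hx0 : 0 < ‖x‖ := hρ.trans_le h
  have hy : ‖(D.ρ / 2 / ‖x‖) • x‖ = D.ρ / 2 := by
    rw [norm_smul, Real.norm_of_nonneg (by positivity)]
    field_simp
  have hmem : (D.ρ / 2 / ‖x‖) • x ∈ Metric.ball 0 D.ρ := by
    rw [mem_ball_zero_iff, hy]; linarith
  have hk : D.k₁ ≤ D.k₂ := by
    have := (D.lower _ hmem).trans (D.upper _ hmem)
    rw [hy] at this
    exact le_of_mul_le_mul_right this (by positivity)
  have hsqrt : √(D.k₁ / D.k₂) ≤ 1 := Real.sqrt_le_one.2 ((div_le_one hk₂).2 hk)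
  nlinarith

/-- For `δ < δ⁺`, a solution starting within `ρ √(k₁ / k₂)` never leaves the ball of radius `ρ`:
`W` stays below a level `c < k₁ ρ²`, at which it would decrease. -/
theorem norm_lt_of_isSolutionOn (huhat : ∀ x, uhat x ∈ P.U) (hustar : ∀ x, ustar x ∈ P.U) {δ : ℝ}
    (hδ : 0 ≤ δ) (herr : ∀ x ∈ Metric.ball 0 D.ρ, ‖uhat x - ustar x‖ ≤ δ)
    (hδlt : δ < D.deltaPlus) {x : ℝ → EuclideanSpace ℝ (Fin n)}
    (hsol : IsSolutionOn (P.closedLoop uhat) x (Set.Ici 0))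
    (hx0 : ‖x 0‖ < D.ρ * √(D.k₁ / D.k₂)) : ∀ t, 0 ≤ t → ‖x t‖ < D.ρ := by
  have hk₁ := D.k₁_pos; have hk₂ := D.k₂_pos; have hρ := D.ρ_pos
  have hxcont : ContinuousOn x (Set.Ici 0) := fun t ht => (hsol t ht).continuousWithinAt
  have hc1 := D.k₂_mul_sq_lt (norm_nonneg (x 0)) hx0
  have hc2 := D.k₂_mul_sq_lt (D.deadRadius_nonneg hδ) (D.deadRadius_lt hδlt)
  obtain ⟨c, hcl, hcr⟩ := exists_between (max_lt hc1 hc2)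
  rw [max_lt_iff] at hcl
  have hc : 0 < c := lt_of_le_of_lt (by positivity) hcl.1
  -- Below the level `c`, the norm is at most `√(c / k₁) < ρ`.
  have hlt : √(c / D.k₁) < D.ρ := by
    rw [Real.sqrt_lt' hρ, div_lt_iff₀ hk₁]; linarith
  have hnorm : ∀ y ∈ Metric.ball (0 : EuclideanSpace ℝ (Fin n)) D.ρ, D.W y ≤ c →
      ‖y‖ ≤ √(c / D.k₁) := fun y hy hyc => by
    refine Real.le_sqrt_of_sq_le ?_
    rw [le_div_iff₀ hk₁]
    linarith [D.lower y hy]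
  refine lt_of_forall_prior_lt hxcont.norm fun t ht hprior => ?_
  rcases ht.eq_or_lt with rfl | ht'
  · exact D.norm_lt_of_norm_lt_mul hx0
  · have hball : ∀ s, 0 ≤ s → s < t → x s ∈ Metric.ball 0 D.ρ := fun s h0 hs => by
      simpa using hprior s h0 hs
    have hWle : ∀ s ∈ Set.Ico 0 t, D.W (x s) ≤ c := fun s hs => by
      refine le_of_deriv_neg_on_level (v := fun s => D.W (x s))
        (v' := fun s => fderiv ℝ D.W (x s) (P.closedLoop uhat (x s))) (a := 0) (b := s)
        (fun u hu => ?_) (fun u hu => ?_) ?_ (fun u hu huc => ?_) s ⟨hs.1, le_rfl⟩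
      · exact (D.hasDerivWithinAt_W hsol hu.1
          (hball u hu.1 (hu.2.trans_lt hs.2))).continuousWithinAt.mono Set.Icc_subset_Ici_self
      · exact (D.hasDerivWithinAt_W hsol hu.1
          (hball u hu.1 (hu.2.trans hs.2))).mono (Set.Ici_subset_Ici.2 hu.1)
      · exact (D.upper _ (hball 0 le_rfl ht')).trans hcl.1.le
      · have hb := hball u hu.1 (hu.2.trans hs.2)
        refine (D.fderiv_le huhat hustar hb (herr _ hb) (hcl.2.le.trans huc.ge)).trans_lt ?_
        have := D.rate_pos
        rw [huc]
        nlinarith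
    refine lt_of_le_of_lt ?_ hlt
    have hcl' : closure (Set.Ico 0 t) = Set.Icc 0 t := closure_Ico ht'.ne
    refine le_on_closure (s := Set.Ico 0 t) (f := fun s => ‖x s‖)
      (fun u hu => hnorm _ (hball u hu.1 hu.2) (hWle u hu)) ?_ continuousOn_const
      (by rw [hcl']; exact ⟨ht, le_rfl⟩)
    rw [hcl']
    exact hxcont.norm.mono Set.Icc_subset_Ici_self

/-- For `δ < δ⁺`, the solutions starting within `ρ √(k₁ / k₂)` decay exponentially until `W` is at
most `k₂ s²`, for `s` the radius `L k₄ δ / (θ k₃)`, and from then on are at most `√(k₂ / k₁) s`. -/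
theorem ultimately_bounded (huhat : ∀ x, uhat x ∈ P.U) (hustar : ∀ x, ustar x ∈ P.U) {δ : ℝ}
    (hδ : 0 ≤ δ) (herr : ∀ x ∈ Metric.ball 0 D.ρ, ‖uhat x - ustar x‖ ≤ δ)
    (hδlt : δ < D.deltaPlus) {x : ℝ → EuclideanSpace ℝ (Fin n)}
    (hsol : IsSolutionOn (P.closedLoop uhat) x (Set.Ici 0))
    (hx0 : ‖x 0‖ < D.ρ * √(D.k₁ / D.k₂)) :
    (0 < δ → ∃ T : ℝ, 0 ≤ T ∧
      (∀ t, 0 ≤ t → t < T → ‖x t‖ ≤ D.gain * ‖x 0‖ * Real.exp (-D.rate * t)) ∧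
      ∀ t, T ≤ t → ‖x t‖ ≤ D.bound δ) ∧
    (δ = 0 → ∀ t, 0 ≤ t → ‖x t‖ ≤ D.gain * ‖x 0‖ * Real.exp (-D.rate * t)) := by
  have hk₁ := D.k₁_pos; have hk₂ := D.k₂_pos
  have hball : ∀ t, 0 ≤ t → x t ∈ Metric.ball 0 D.ρ := fun t ht => by
    simpa using D.norm_lt_of_isSolutionOn huhat hustar hδ herr hδlt hsol hx0 t ht
  have hderiv : ∀ t, 0 ≤ t → HasDerivWithinAt (fun t => D.W (x t))
      (fderiv ℝ D.W (x t) (P.closedLoop uhat (x t))) (Set.Ici 0) t := fun t ht =>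
    D.hasDerivWithinAt_W hsol ht (hball t ht)
  have hdecr : ∀ t, 0 ≤ t → D.k₂ * D.deadRadius δ ^ 2 ≤ D.W (x t) →
      fderiv ℝ D.W (x t) (P.closedLoop uhat (x t)) ≤ -(2 * D.rate) * D.W (x t) := fun t ht h =>
    D.fderiv_le huhat hustar (hball t ht) (herr _ (hball t ht)) h
  have hdecay : ∀ t, 0 ≤ t → D.W (x t) ≤ D.W (x 0) * Real.exp (-(2 * D.rate) * t) →
      ‖x t‖ ≤ D.gain * ‖x 0‖ * Real.exp (-D.rate * t) := fun t ht h => by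
    rw [mul_assoc]
    refine D.le_gain_mul (by positivity) ?_
    have hexp : Real.exp (-(2 * D.rate) * t) = Real.exp (-D.rate * t) ^ 2 := by
      rw [← Real.exp_nat_mul]; congr 1; push_cast; ring
    rw [mul_pow, ← mul_assoc, ← hexp]
    exact (D.lower _ (hball t ht)).trans (h.trans
      (mul_le_mul_of_nonneg_right (D.upper _ (hball 0 le_rfl)) (Real.exp_pos _).le))
  refine ⟨fun hpos => ?_, fun hzero t ht => ?_⟩
  · have hs := D.deadRadius_pos hpos
    obtain ⟨T, hT, h1, h2⟩ := exists_time_decay_then_le (v := fun t => D.W (x t))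
      (mul_pos two_pos D.rate_pos) (mul_pos hk₂ (pow_pos hs 2)) hderiv hdecr
    refine ⟨T, hT, fun t ht htT => hdecay t ht (h1 t ht htT), fun t ht => ?_⟩
    rw [D.bound_eq]
    exact D.le_gain_mul hs.le ((D.lower _ (hball t (hT.trans ht))).trans (h2 t ht))
  · have hcont : ContinuousOn (fun t => D.W (x t)) (Set.Ici 0) := fun t ht =>
      (hderiv t ht).continuousWithinAt
    refine hdecay t ht (le_mul_exp_of_deriv_le (v := fun t => D.W (x t))
      (hcont.mono Set.Icc_subset_Ici_self)
      (fun s hs => (hderiv s hs.1).mono (Set.Ici_subset_Ici.2 hs.1))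
      (fun s hs => hdecr s hs.1 ?_) t ⟨ht, le_rfl⟩)
    have h0 : D.deadRadius δ = 0 := by simp [deadRadius, hzero]
    rw [h0]
    have := D.lower _ (hball s hs.1)
    have : 0 ≤ D.k₁ * ‖x s‖ ^ 2 := by positivity
    linarith

end ThresholdData

end ControlProblem

/-! ### Probability of a reliable empirical maximum -/

theorem measureReal_exists_notMem_eq {α Ω : Type*} [MeasurableSpace α] [MeasurableSpace Ω]
    {N : ℕ} {μ : Measure α} {Pr : Measure Ω} [IsProbabilityMeasure Pr] {X : Fin N → Ω → α}
    (hX : ∀ i, Measurable (X i)) (hlaw : ∀ i, Pr.map (X i) = μ)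
    (hindep : ProbabilityTheory.iIndepFun X Pr) {S : Set α} (hS : NullMeasurableSet S μ) :
    Pr.real {w | ∃ i, X i w ∉ S} = 1 - μ.real S ^ N := by
  have hae : ∀ᵐ w ∂Pr, ∀ i, X i w ∈ S ↔ X i w ∈ toMeasurable μ S := by
    rw [ae_all_iff]
    intro i
    have h : ∀ᵐ x ∂(Pr.map (X i)), x ∈ S ↔ x ∈ toMeasurable μ S := by
      rw [hlaw i]
      exact (hS.toMeasurable_ae_eq.mem_iff).mono fun x hx => hx.symm
    exact ae_of_ae_map (hX i).aemeasurable h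
  have hset : {w | ∀ i, X i w ∈ S} =ᵐ[Pr] ⋂ i ∈ Finset.univ, X i ⁻¹' toMeasurable μ S := by
    filter_upwards [hae] with w hw
    refine propext ?_
    change (∀ i, X i w ∈ S) ↔ w ∈ ⋂ i ∈ Finset.univ, X i ⁻¹' toMeasurable μ S
    simp [hw]
  have hmeas := measurableSet_toMeasurable μ S
  have hnull : NullMeasurableSet {w | ∀ i, X i w ∈ S} Pr :=
    (MeasurableSet.nullMeasurableSet (Finset.measurableSet_biInter _ fun i _ =>
      hX i hmeas)).congr hset.symm
  have hcompl : {w | ∃ i, X i w ∉ S} = {w | ∀ i, X i w ∈ S}ᶜ := by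
    ext w; exact not_forall.symm
  rw [hcompl, probReal_compl_eq_one_sub₀ hnull, measureReal_congr hset, measureReal_def,
    hindep.measure_inter_preimage_eq_mul Finset.univ fun i _ => hmeas]
  have hi : ∀ i, Pr (X i ⁻¹' toMeasurable μ S) = μ S := fun i => by
    rw [← Measure.map_apply (hX i) hmeas, hlaw i, measure_toMeasurable]
  simp [hi, measureReal_def]

section

variable {n m : ℕ} {uhat ustar : EuclideanSpace ℝ (Fin n) → EuclideanSpace ℝ (Fin m)} {r : ℝ}
  {μ : Measure (EuclideanSpace ℝ (Fin n))}

theorem continuousOn_controlError (huhat : Continuous uhat)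
    (hustar : ContinuousOn ustar (Metric.closedBall 0 r)) :
    ContinuousOn (controlError uhat ustar) (Metric.closedBall 0 r) :=
  (huhat.continuousOn.sub hustar).norm

theorem isGreatest_maxError (hr : 0 ≤ r)
    (hcont : ContinuousOn (controlError uhat ustar) (Metric.closedBall 0 r)) :
    IsGreatest (controlError uhat ustar '' Metric.closedBall 0 r) (maxError uhat ustar r) :=
  ((isCompact_closedBall _ _).image_of_continuousOn hcont).isGreatest_sSup
    ((Metric.nonempty_closedBall.2 hr).image _)

/-- `ustar` is arbitrary outside the ball, but the ball carries the whole mass of `μ`. -/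
theorem nullMeasurableSet_preimage_controlError (hμ : μ.support = Metric.closedBall 0 r)
    (hcont : ContinuousOn (controlError uhat ustar) (Metric.closedBall 0 r)) {s : Set ℝ}
    (hs : MeasurableSet s) : NullMeasurableSet (controlError uhat ustar ⁻¹' s) μ := by
  have hball : Metric.closedBall 0 r ∈ ae μ := hμ ▸ Measure.support_mem_ae
  have h := (hcont.aemeasurable (μ := μ) Metric.isClosed_closedBall.measurableSet)
  rw [Measure.restrict_eq_self_of_ae_mem (s := Metric.closedBall 0 r) hball] at h
  exact h.nullMeasurable hs

/-- Near a maximizer of the error, which lies in the support of `μ`, the gap is less than `ε`. -/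
theorem weakGapProb_lt_one [IsProbabilityMeasure μ] (hr : 0 ≤ r)
    (hμ : μ.support = Metric.closedBall 0 r)
    (hcont : ContinuousOn (controlError uhat ustar) (Metric.closedBall 0 r)) {ε : ℝ}
    (hε : 0 < ε) : weakGapProb uhat ustar μ (maxError uhat ustar r) ε < 1 := by
  obtain ⟨x, hx, hxmax⟩ := (isGreatest_maxError hr hcont).1
  set S := {x | maxError uhat ustar r - controlError uhat ustar x ≥ ε} with hS
  have hnull : NullMeasurableSet S μ :=
    nullMeasurableSet_preimage_controlError hμ hcont
      (s := {y | maxError uhat ustar r - y ≥ ε}) (by measurability)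
  have hpos : 0 < μ Sᶜ := by
    have hnear : ∀ᶠ y in nhdsWithin x (Metric.closedBall 0 r), y ∈ Sᶜ := by
      have h1 : maxError uhat ustar r - ε < controlError uhat ustar x := by linarith
      filter_upwards [(hcont x hx).eventually_const_lt h1] with y hy
      simp only [hS, Set.mem_compl_iff, Set.mem_ofPred_eq, not_le, ge_iff_le]
      linarith
    obtain ⟨V, hV, hVS⟩ := mem_nhdsWithin_iff_exists_mem_nhds_inter.1 hnear
    have hVpos : 0 < μ V := (Measure.mem_support_iff_forall x).1 (hμ ▸ hx) V hV
    have hball : Metric.closedBall 0 r ∈ ae μ := hμ ▸ Measure.support_mem_ae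
    rw [← measure_inter_conull (mem_ae_iff.1 hball)] at hVpos
    exact hVpos.trans_le (measure_mono hVS)
  have h := probReal_compl_eq_one_sub₀ hnull
  have h2 : 0 < μ.real Sᶜ := ENNReal.toReal_pos hpos.ne' (measure_ne_top _ _)
  change μ.real S < 1
  linarith

theorem gapProb_le_weakGapProb [IsProbabilityMeasure μ] (δ ε : ℝ) :
    gapProb uhat ustar μ δ ε ≤ weakGapProb uhat ustar μ δ ε :=
  measureReal_mono fun x (hx : δ - controlError uhat ustar x > ε) => hx.le

theorem exists_empiricalError_eq {N : ℕ} (hN : 0 < N) (x : Fin N → EuclideanSpace ℝ (Fin n)) :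
    ∃ j, controlError uhat ustar (x j) = empiricalError uhat ustar x := by
  have : Nonempty (Fin N) := ⟨⟨0, hN⟩⟩
  exact exists_eq_ciSup_of_finite

theorem controlError_le_empiricalError {N : ℕ} (x : Fin N → EuclideanSpace ℝ (Fin n)) (i : Fin N) :
    controlError uhat ustar (x i) ≤ empiricalError uhat ustar x :=
  le_ciSup (f := fun i => controlError uhat ustar (x i)) (Set.finite_range _).bddAbove i

theorem le_empiricalError_iff {N : ℕ} (hN : 0 < N) {x : Fin N → EuclideanSpace ℝ (Fin n)} {c : ℝ} :
    c ≤ empiricalError uhat ustar x ↔ ∃ i, c ≤ controlError uhat ustar (x i) := by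
  refine ⟨fun h => ?_, fun ⟨i, hi⟩ => hi.trans (controlError_le_empiricalError x i)⟩
  obtain ⟨j, hj⟩ := exists_empiricalError_eq (uhat := uhat) (ustar := ustar) hN x
  exact ⟨j, hj ▸ h⟩

theorem lt_empiricalError_iff {N : ℕ} (hN : 0 < N) {x : Fin N → EuclideanSpace ℝ (Fin n)} {c : ℝ} :
    c < empiricalError uhat ustar x ↔ ∃ i, c < controlError uhat ustar (x i) := by
  refine ⟨fun h => ?_, fun ⟨i, hi⟩ => hi.trans_le (controlError_le_empiricalError x i)⟩
  obtain ⟨j, hj⟩ := exists_empiricalError_eq (uhat := uhat) (ustar := ustar) hN x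
  exact ⟨j, hj ▸ h⟩

/-- The empirical maximum misses `δ` by more than `ε` exactly when every single test point does. -/
theorem measureReal_le_empiricalError_add {N : ℕ} (hN : 0 < N)
    (hμ : μ.support = Metric.closedBall 0 r)
    (hcont : ContinuousOn (controlError uhat ustar) (Metric.closedBall 0 r))
    {Ω : Type*} [MeasurableSpace Ω] {Pr : Measure Ω} [IsProbabilityMeasure Pr]
    {X : Fin N → Ω → EuclideanSpace ℝ (Fin n)} (hX : ∀ i, Measurable (X i))
    (hlaw : ∀ i, Pr.map (X i) = μ) (hindep : ProbabilityTheory.iIndepFun X Pr) (δ ε : ℝ) :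
    Pr.real {w | δ ≤ empiricalError uhat ustar (fun i => X i w) + ε}
      = 1 - gapProb uhat ustar μ δ ε ^ N := by
  have hS : NullMeasurableSet {x | δ - controlError uhat ustar x > ε} μ :=
    nullMeasurableSet_preimage_controlError hμ hcont
      (s := {y | δ - y > ε}) (by measurability)
  refine Eq.trans (congrArg Pr.real ?_) (measureReal_exists_notMem_eq hX hlaw hindep hS)
  ext w
  change δ ≤ _ ↔ ∃ i, ¬ δ - controlError uhat ustar (X i w) > ε
  rw [← sub_le_iff_le_add, le_empiricalError_iff hN]
  exact exists_congr fun i => by rw [not_lt, sub_le_comm]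

theorem measureReal_lt_empiricalError_add {N : ℕ} (hN : 0 < N)
    (hμ : μ.support = Metric.closedBall 0 r)
    (hcont : ContinuousOn (controlError uhat ustar) (Metric.closedBall 0 r))
    {Ω : Type*} [MeasurableSpace Ω] {Pr : Measure Ω} [IsProbabilityMeasure Pr]
    {X : Fin N → Ω → EuclideanSpace ℝ (Fin n)} (hX : ∀ i, Measurable (X i))
    (hlaw : ∀ i, Pr.map (X i) = μ) (hindep : ProbabilityTheory.iIndepFun X Pr) (δ ε : ℝ) :
    Pr.real {w | δ < empiricalError uhat ustar (fun i => X i w) + ε}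
      = 1 - weakGapProb uhat ustar μ δ ε ^ N := by
  have hS : NullMeasurableSet {x | δ - controlError uhat ustar x ≥ ε} μ :=
    nullMeasurableSet_preimage_controlError hμ hcont
      (s := {y | δ - y ≥ ε}) (by measurability)
  refine Eq.trans (congrArg Pr.real ?_) (measureReal_exists_notMem_eq hX hlaw hindep hS)
  ext w
  change δ < _ ↔ ∃ i, ¬ δ - controlError uhat ustar (X i w) ≥ ε
  rw [← sub_lt_iff_lt_add, lt_empiricalError_iff hN]
  exact exists_congr fun i => by rw [not_le, sub_lt_comm]

end

theorem mainTheorem1 {n m N : ℕ} (hN : 0 < N)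
    -- the optimal control problem and its optimal feedback
    (P : ControlProblem n m)
    (ustar : EuclideanSpace ℝ (Fin n) → EuclideanSpace ℝ (Fin m))
    (hopt : P.IsOptimalFeedback ustar)
    (r : ℝ) (hr : 0 < r)
    (hustar : ContinuousOn ustar (Metric.closedBall 0 r))
    (hLip : HasLipschitzJacobianOnBall (P.closedLoop ustar) r)
    (hexp : IsExpStableEquilibrium (P.closedLoop ustar))
    -- the approximate feedback
    (uhat : EuclideanSpace ℝ (Fin n) → EuclideanSpace ℝ (Fin m))
    (huhat : Continuous uhat) (huhatU : ∀ x, uhat x ∈ P.U)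
    -- independent test points with common law `μ`, whose support is the closed ball
    (μ : Measure (EuclideanSpace ℝ (Fin n))) [IsProbabilityMeasure μ]
    (hμ : μ.support = Metric.closedBall 0 r)
    {Ω : Type*} [MeasurableSpace Ω] (Pr : Measure Ω) [IsProbabilityMeasure Pr]
    (X : Fin N → Ω → EuclideanSpace ℝ (Fin n)) (hX : ∀ i, Measurable (X i))
    (hlaw : ∀ i, Pr.map (X i) = μ) (hindep : ProbabilityTheory.iIndepFun X Pr) :
    -- the maximum in the definition of `δ` is attained
    IsGreatest (controlError uhat ustar '' Metric.closedBall 0 r) (maxError uhat ustar r) ∧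
    -- thresholds `δ⁺` exist
    Nonempty (P.ThresholdData ustar r) ∧
    ∀ D : P.ThresholdData ustar r,
      -- `δ < δ⁺` is a sufficient condition for ultimate boundedness
      (maxError uhat ustar r < D.deltaPlus →
        ∀ x : ℝ → EuclideanSpace ℝ (Fin n),
          IsSolutionOn (P.closedLoop uhat) x (Set.Ici 0) → ‖x 0‖ < D.ρ * √(D.k₁ / D.k₂) →
            (0 < maxError uhat ustar r →
              ∃ T : ℝ, 0 ≤ T ∧
                (∀ t, 0 ≤ t → t < T → ‖x t‖ ≤ D.gain * ‖x 0‖ * Real.exp (-D.rate * t)) ∧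
                ∀ t, T ≤ t → ‖x t‖ ≤ D.bound (maxError uhat ustar r)) ∧
            (maxError uhat ustar r = 0 →
              ∀ t, 0 ≤ t → ‖x t‖ ≤ D.gain * ‖x 0‖ * Real.exp (-D.rate * t))) ∧
      -- the observed estimate `δ_N(w₀)` is below `δ⁺`, with margin `ε = δ⁺ - δ_N(w₀)`
      ∀ w₀ : Ω, empiricalError uhat ustar (fun i => X i w₀) < D.deltaPlus →
        ∀ ε : ℝ, ε = D.deltaPlus - empiricalError uhat ustar (fun i => X i w₀) →
          (Pr.real {w | maxError uhat ustar r ≤ empiricalError uhat ustar (fun i => X i w) + ε}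
              = 1 - gapProb uhat ustar μ (maxError uhat ustar r) ε ^ N ∧
            0 < 1 - gapProb uhat ustar μ (maxError uhat ustar r) ε ^ N ∧
            gapProb uhat ustar μ (maxError uhat ustar r) ε < 1) ∧
          (Pr.real {w | maxError uhat ustar r < empiricalError uhat ustar (fun i => X i w) + ε}
              = 1 - weakGapProb uhat ustar μ (maxError uhat ustar r) ε ^ N ∧
            0 < 1 - weakGapProb uhat ustar μ (maxError uhat ustar r) ε ^ N ∧
            weakGapProb uhat ustar μ (maxError uhat ustar r) ε < 1) := by
  have hcont := continuousOn_controlError huhat hustar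
  have hmax := isGreatest_maxError hr.le hcont
  have herr : ∀ x ∈ Metric.closedBall 0 r, ‖uhat x - ustar x‖ ≤ maxError uhat ustar r :=
    fun x hx => hmax.2 (Set.mem_image_of_mem _ hx)
  have hδ : 0 ≤ maxError uhat ustar r :=
    (norm_nonneg _).trans (herr 0 (Metric.mem_closedBall_self hr.le))
  refine ⟨hmax, P.nonempty_thresholdData hopt hr hLip.1 hexp, fun D => ⟨fun hlt x hsol hx0 => ?_,
    fun w₀ hw₀ ε hε => ?_⟩⟩
  · exact D.ultimately_bounded huhatU hopt.1 hδ (fun y hy => herr y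
      (Metric.ball_subset_closedBall (Metric.ball_subset_ball D.ρ_le hy))) hlt hsol hx0
  · have hε0 : 0 < ε := hε ▸ sub_pos.2 hw₀
    have hweak := weakGapProb_lt_one hr.le hμ hcont hε0
    have hgap := (gapProb_le_weakGapProb (uhat := uhat) (ustar := ustar) (μ := μ)
      (maxError uhat ustar r) ε).trans_lt hweak
    exact ⟨⟨measureReal_le_empiricalError_add hN hμ hcont hX hlaw hindep _ _,
        sub_pos.2 (pow_lt_one₀ measureReal_nonneg hgap hN.ne'), hgap⟩,
      measureReal_lt_empiricalError_add hN hμ hcont hX hlaw hindep _ _,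
      sub_pos.2 (pow_lt_one₀ measureReal_nonneg hweak hN.ne'), hweak⟩
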